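/- Let $M\ge 0$. For real polynomials $p$ put $$c_1(p)=\int_0^\infty p(x)e^{-x}\,dx,\qquad c_0(p)=c_1(p)+M\,p(0).$$ Let $P_j$ and $T_j$ ($j\ge 0$) be the monic orthogonal polynomials of $c_0$ and of $c_1$, respectively, and let $k_j^{(0)}=c_0(P_j^2)$, $k_j^{(1)}=c_1(T_j^2)$. The pair $(c_0,c_1)$ is coherent: there are real numbers $\sigma_j\neq 0$ with $$T_j=\frac{P_{j+1}'}{j+1}-\sigma_j\frac{P_j'}{j}\qquad (j\ge 1).$$ For $n\ge 1$ let $\tilde K_n$ be the $n\times n$ symmetric tridiagonal matrix with entries $$\tilde K_n(1,1)=\frac{k_1^{(0)}}{k_0^{(1)}},\qquad \tilde K_n(i,i)=\frac{k_i^{(0)}}{i^2k_{i-1}^{(1)}}+\frac{\sigma_{i-1}^2}{(i-1)^2}\frac{k_{i-1}^{(0)}}{k_{i-1}^{(1)}}\quad(2\le i\le n),$$ $$\tilde K_n(i+1,i)=\tilde K_n(i,i+1)=-\frac{\sigma_i k_i^{(0)}}{i^2\sqrt{k_{i-1}^{(1)}k_i^{(1)}}}\quad(1\le i\le n-1),$$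 let $A_n(\lambda)=\det(\lambda I-\tilde K_n)$, and let $\mu_{1,n}$ be the smallest (real) zero of $A_n$. Let $M_n$ be the Markov–Bernstein constant, that is, the least $K\ge 0$ such that $c_1((p')^2)\le K^2c_0(p^2)$ for all real polynomials $p$ of degree at most $n$. (Both the smallest zero and the least constant exist.) The qd algorithm starts from $$q_j^{(0)}=\frac{k_j^{(0)}}{j^2k_{j-1}^{(1)}}\ (1\le j\le n),\qquad e_j^{(0)}=\frac{\sigma_j^2}{j^2}\frac{k_j^{(0)}}{k_j^{(1)}}\ (1\le j\le n-1),\qquad e_0^{(0)}=e_n^{(0)}=0,$$ and for $r=0,1,\dots$ computes $q^{(r+1)},e^{(r+1)}$ from $e_0^{(r+1)}=e_n^{(r+1)}=0$ and $$q_{j}^{(r+1)}+e_{j-1}^{(r+1)}=q_{j}^{(r)}+e_{j}^{(r)}\ (1\le j\le n),\qquad q_j^{(r+1)}e_j^{(r+1)}=q_{j+1}^{(r)}e_j^{(r)}\ (1\le j\le n-1).$$ Then for every $n\ge 1$, $$q_n^{(2)}=\frac{30\,(1+(n+1)M)}{(n+1)(2n+1)}\cdot\frac{p_{n-1}^{(1)}}{p_{n-1}^{(2)}},$$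 where $$p_j^{(1)}=1+M(2+j)+\tfrac{M^2}{6}(2+j)(3+2j),$$ $$p_j^{(2)}=5+5M(3+j)+M^2(3+j)(5+2j)+\tfrac{M^3}{6}(2+j)(3+j)(5+2j).$$ Moreover $\mu_{1,n}<q_n^{(2)}$ for every $n\ge 2$, while $\mu_{1,1}=q_1^{(2)}$, and for every $n\ge 1$ $$\frac1{\sqrt{q_n^{(2)}}}\le M_n\le\sqrt{\frac{n(n+1)(3+(n+2)M)}{1+(n+1)M}}.$$ -/

import Mathlib

open Polynomial

namespace LaguerreDirac

/-- The functional `c₁` of the Laguerre measure `e^{-x} dx` on `(0, ∞)`. -/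
noncomputable def c1 (p : ℝ[X]) : ℝ :=
  ∫ x in Set.Ioi (0 : ℝ), p.eval x * Real.exp (-x)

/-- The functional `c₀` of the measure `e^{-x} dx + M δ(0)`. -/
noncomputable def c0 (M : ℝ) (p : ℝ[X]) : ℝ :=
  c1 p + M * p.eval 0

/-- The monic orthogonal polynomials of a functional `c`, by the Gram-Schmidt process applied to
`1, X, X ^ 2, …`. -/
noncomputable def monicOP (c : ℝ[X] → ℝ) (n : ℕ) : ℝ[X] :=
  X ^ n - ∑ i : Fin n,
    C (c (X ^ n * monicOP c i) / c (monicOP c i ^ 2)) * monicOP c i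
termination_by n
decreasing_by all_goals exact i.isLt

/-- `P_n`, the monic orthogonal polynomials of `c₀`. -/
noncomputable def P (M : ℝ) (n : ℕ) : ℝ[X] := monicOP (c0 M) n

/-- `T_n`, the monic orthogonal polynomials of `c₁`. -/
noncomputable def T (n : ℕ) : ℝ[X] := monicOP c1 n

/-- The square norm `k_n^{(0)} = c₀(P_n²)`. -/
noncomputable def k0 (M : ℝ) (n : ℕ) : ℝ := c0 M (P M n ^ 2)

/-- The square norm `k_n^{(1)} = c₁(T_n²)`. -/
noncomputable def k1 (n : ℕ) : ℝ := c1 (T n ^ 2)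

/-- The coefficient `σ_n` (`n ≥ 1`) of the coherence relation
`T_n = P'_{n+1} / (n+1) - σ_n P'_n / n`. As `P'_n / n` is monic of degree `n - 1`, the relation
forces `σ_n` to be the coefficient of `x^{n-1}` in `P'_{n+1} / (n+1) - T_n`. -/
noncomputable def σ (M : ℝ) (n : ℕ) : ℝ :=
  (C (1 / ((n : ℝ) + 1)) * derivative (P M (n + 1)) - T n).coeff (n - 1)

/-- The coherence relation for `(c₀, c₁)` with the coefficients `σ_n`. -/
def IsCoherent (M : ℝ) : Prop :=
  ∀ n : ℕ, 1 ≤ n → σ M n ≠ 0 ∧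
    T n = C (1 / ((n : ℝ) + 1)) * derivative (P M (n + 1))
      - C (σ M n / (n : ℝ)) * derivative (P M n)

/-- `q_j^{(0)} = k_j^{(0)} / (j² k_{j-1}^{(1)})`, for `j ≥ 1`. -/
noncomputable def q0 (M : ℝ) (j : ℕ) : ℝ := k0 M j / ((j : ℝ) ^ 2 * k1 (j - 1))

/-- `e_j^{(0)} = (σ_j² / j²) (k_j^{(0)} / k_j^{(1)})` for `1 ≤ j ≤ n - 1`, and
`e_0^{(0)} = e_n^{(0)} = 0`. -/
noncomputable def e0 (M : ℝ) (n j : ℕ) : ℝ :=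
  if 1 ≤ j ∧ j < n then σ M j ^ 2 / (j : ℝ) ^ 2 * (k0 M j / k1 j) else 0

/-- The entry `(i, i+1)`, `i ≥ 1`, of the tridiagonal matrix `K̃_{n,1}`. -/
noncomputable def offDiag (M : ℝ) (i : ℕ) : ℝ :=
  -(σ M i * k0 M i) / ((i : ℝ) ^ 2 * Real.sqrt (k1 (i - 1) * k1 i))

/-- The symmetric tridiagonal matrix `K̃_{n,1}`; the index `i : Fin n` stands for the row `i + 1`.
Its diagonal entry in row `i` is
`k_i^{(0)} / (i² k_{i-1}^{(1)}) + (σ_{i-1}² / (i-1)²) (k_{i-1}^{(0)} / k_{i-1}^{(1)})`, without the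
second term for `i = 1`. -/
noncomputable def Ktilde (M : ℝ) (n : ℕ) : Matrix (Fin n) (Fin n) ℝ :=
  Matrix.of fun i j =>
    if (i : ℕ) = j then q0 M (i + 1) + e0 M n i
    else if (j : ℕ) = i + 1 then offDiag M (i + 1)
    else if (i : ℕ) = j + 1 then offDiag M (j + 1)
    else 0

/-- `A_n(λ) = det (λ I - K̃_{n,1})`. -/
noncomputable def A (M : ℝ) (n : ℕ) : ℝ[X] := (Ktilde M n).charpoly

/-- `μ_{1,n}`, the smallest zero of `A_n`. -/
noncomputable def mu1 (M : ℝ) (n : ℕ) : ℝ := sInf {x : ℝ | (A M n).eval x = 0}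

/-- The `q`-part of one step of the qd algorithm: `q'_j + e'_{j-1} = q_j + e_j`, where
`e'_0 = 0` and `q'_j e'_j = q_{j+1} e_j` (the entry of index `0` is not used). -/
noncomputable def qdStepQ (q e : ℕ → ℝ) : ℕ → ℝ
  | 0 => 0
  | 1 => q 1 + e 1
  | j + 2 => q (j + 2) + e (j + 2) - q (j + 2) * e (j + 1) / qdStepQ q e (j + 1)

/-- The `e`-part of one step of the qd algorithm: `e'_j = q_{j+1} e_j / q'_j`. If `e_j` vanishes for
`j = 0` and for `j ≥ n`, then so does `e'_j`. -/
noncomputable def qdStepE (q e : ℕ → ℝ) (j : ℕ) : ℝ := q (j + 1) * e j / qdStepQ q e j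

/-- The sequences `(q_j^{(r)}, e_j^{(r)})` that the qd algorithm computes from `q_j^{(0)}`,
`e_j^{(0)}`, `j ≤ n`. -/
noncomputable def qd (M : ℝ) (n : ℕ) : ℕ → (ℕ → ℝ) × (ℕ → ℝ)
  | 0 => (q0 M, e0 M n)
  | r + 1 => (qdStepQ (qd M n r).1 (qd M n r).2, qdStepE (qd M n r).1 (qd M n r).2)

/-- `q_j^{(r)}`. -/
noncomputable def qdQ (M : ℝ) (n r j : ℕ) : ℝ := (qd M n r).1 j

/-- `p_j^{(1)} = 1 + M (2 + j) + (M² / 6) (2 + j) (3 + 2 j)`. -/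
noncomputable def p1 (M j : ℝ) : ℝ :=
  1 + M * (2 + j) + M ^ 2 / 6 * (2 + j) * (3 + 2 * j)

/-- `p_j^{(2)} = 5 + 5 M (3 + j) + M² (3 + j) (5 + 2 j) + (M³ / 6) (2 + j) (3 + j) (5 + 2 j)`. -/
noncomputable def p2 (M j : ℝ) : ℝ :=
  5 + 5 * M * (3 + j) + M ^ 2 * (3 + j) * (5 + 2 * j)
    + M ^ 3 / 6 * (2 + j) * (3 + j) * (5 + 2 * j)

/-- The constants `K ≥ 0` for which `c₁((p')²) ≤ K² c₀(p²)` for all real polynomials `p` of degree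
at most `n`. -/
def markovBernsteinConstants (M : ℝ) (n : ℕ) : Set ℝ :=
  {K : ℝ | 0 ≤ K ∧ ∀ p : ℝ[X], p.natDegree ≤ n →
    c1 (derivative p ^ 2) ≤ K ^ 2 * c0 M (p ^ 2)}

/-- The Markov-Bernstein constant `M_n`: the best constant in the inequality above. -/
noncomputable def markovBernstein (M : ℝ) (n : ℕ) : ℝ := sInf (markovBernsteinConstants M n)

end LaguerreDirac

/-! Write `b t = 1 + M t`. The polynomials `T_n` are the monic Laguerre polynomials, with norms
`n!²`, and `P_n = T_n + (M / b_n) T_n'`. All data become explicit: `σ_n = -n b_n / b_{n+1}`, `q_j =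
b_{j+1} / b_j`, `e_j = b_j / b_{j+1}`, off-diagonal entries 1. Hence `Ktilde = R Rᵀ` with `R =
bidiag` lower bidiagonal (`Ktilde_eq`).

If `p' = ∑ x_j T_j / j!`, coherence gives `c₁(p'²) = |x|²` and `c₀(p²) = |Rᵀ x|² + a² (1 + M)`,
where `a` is the coefficient of `P_0` in `p`. So `M_n` is the inverse square root of `μ_{1,n}`
(`isLeast_markovBernsteinConstants`).

With `B_t = ∑_{k ≤ t} b_k²` and `S_t = b_{t+1} ∑_{k ≤ t} B_k² / (b_k b_{k+1})`, both polynomial in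
`t`, two qd steps have closed forms and `q_n^{(2)} = b_{n+1} B_n / S_n` (`qdQ_two_self`). This
number is also the Rayleigh quotient of `Rᵀ R`, which has the spectrum of `Ktilde`, at the vector
`testVec`; hence it bounds `μ_{1,n}` from above, and for `n ≥ 2` strictly, because `testVec` is not
an eigenvector (`mu1_le_qdQ_two`).

The upper bound of `M_n` comes from solving `Rᵀ v = z` and bounding each `v_j` by Cauchy-Schwarz
(`sq_mul_b_le`, `sum_sq_le`). -/

namespace LaguerreDirac

/-! ### The functionals -/

theorem integrableOn_eval_mul_exp_neg (p : ℝ[X]) :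
    MeasureTheory.IntegrableOn (fun x : ℝ => p.eval x * Real.exp (-x)) (Set.Ioi 0) := by
  induction p using Polynomial.induction_on' with
  | add p q hp hq =>
    simp only [eval_add, add_mul]
    exact hp.add hq
  | monomial n a =>
    have h := Real.GammaIntegral_convergent (s := n + 1) (by positivity)
    refine MeasureTheory.IntegrableOn.congr_fun (h.const_mul a) (fun x _ => ?_) measurableSet_Ioi
    simp only [eval_monomial, add_sub_cancel_right, Real.rpow_natCast]
    ring

theorem c1_add (p q : ℝ[X]) : c1 (p + q) = c1 p + c1 q := by
  simp only [c1, eval_add, add_mul]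
  exact MeasureTheory.integral_add (integrableOn_eval_mul_exp_neg p)
    (integrableOn_eval_mul_exp_neg q)

theorem c1_smul (a : ℝ) (p : ℝ[X]) : c1 (a • p) = a * c1 p := by
  simp only [c1, eval_smul, smul_eq_mul, mul_assoc]
  exact MeasureTheory.integral_const_mul _ _

/-- `c₁` as a linear map. -/
noncomputable def c1Lin : ℝ[X] →ₗ[ℝ] ℝ where
  toFun := c1
  map_add' := c1_add
  map_smul' := c1_smul

/-- `c₀` as a linear map. -/
noncomputable def c0Lin (M : ℝ) : ℝ[X] →ₗ[ℝ] ℝ where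
  toFun := c0 M
  map_add' p q := by simp only [c0, c1_add, eval_add]; ring
  map_smul' a p := by simp only [c0, c1_smul, eval_smul, smul_eq_mul, RingHom.id_apply]; ring

theorem c1Lin_apply (p : ℝ[X]) : c1Lin p = c1 p := rfl

theorem c0Lin_apply (M : ℝ) (p : ℝ[X]) : c0Lin M p = c1Lin p + M * p.eval 0 := rfl

theorem c1Lin_X_pow (n : ℕ) : c1Lin (X ^ n) = n.factorial := by
  rw [← Real.Gamma_nat_eq_factorial, Real.Gamma_eq_integral (by positivity), c1Lin_apply, c1]
  refine MeasureTheory.setIntegral_congr_fun measurableSet_Ioi fun x _ => ?_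
  simp only [eval_pow, eval_X, add_sub_cancel_right, Real.rpow_natCast]
  ring

theorem c1Lin_one : c1Lin 1 = 1 := by simpa using c1Lin_X_pow 0

/-- Integration by parts. -/
theorem c1Lin_derivative (p : ℝ[X]) : c1Lin (derivative p) = c1Lin p - p.eval 0 := by
  induction p using Polynomial.induction_on' with
  | add p q hp hq =>
    simp only [map_add, eval_add, hp, hq]
    ring
  | monomial n a =>
    rw [← C_mul_X_pow_eq_monomial, derivative_C_mul, ← smul_eq_C_mul, ← smul_eq_C_mul, map_smul,
      map_smul, derivative_X_pow]
    cases n with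
    | zero => simp [c1Lin_one]
    | succ n =>
      rw [← smul_eq_C_mul, map_smul]
      simp [c1Lin_X_pow, Nat.factorial_succ]

/-! ### Orthogonal families -/

section Orthogonal

variable {S : ℕ → ℝ[X]} {c : ℝ[X] →ₗ[ℝ] ℝ}

theorem exists_eq_sum_of_monic (hm : ∀ n, (S n).Monic) (hd : ∀ n, (S n).natDegree = n) (n : ℕ) :
    ∀ p : ℝ[X], p.degree < n → ∃ a : ℕ → ℝ, p = ∑ i ∈ Finset.range n, a i • S i := by
  induction n with
  | zero =>
    intro p hp
    exact ⟨0, by simpa [Polynomial.degree_lt_iff_coeff_zero, Polynomial.ext_iff] using hp⟩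
  | succ n ih =>
    intro p hp
    obtain ⟨a, ha⟩ := ih (p - p.coeff n • S n) (by
      rw [degree_lt_iff_coeff_zero] at hp ⊢
      intro m hmn
      have hn : (S n).coeff n = 1 := by
        have := hm n
        rwa [Monic, leadingCoeff, hd] at this
      rcases hmn.eq_or_lt with rfl | h
      · simp [hn]
      · rw [coeff_sub, coeff_smul, hp m h, coeff_eq_zero_of_natDegree_lt ((hd n).trans_lt h)]
        simp)
    refine ⟨Function.update a n (p.coeff n), ?_⟩
    rw [Finset.sum_range_succ, Function.update_self, ← sub_eq_iff_eq_add, ha]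
    refine Finset.sum_congr rfl fun i hi => ?_
    rw [Function.update_of_ne (Finset.mem_range.1 hi).ne]

theorem map_mul_eq_zero_of_ne (hm : ∀ n, (S n).Monic) (hd : ∀ n, (S n).natDegree = n)
    (ho : ∀ (n : ℕ) (f : ℝ[X]), f.degree < n → c (S n * f) = 0) {i j : ℕ} (h : i ≠ j) :
    c (S i * S j) = 0 := by
  have hdeg (n : ℕ) : (S n).degree = n := by rw [degree_eq_natDegree (hm n).ne_zero, hd]
  rcases h.lt_or_gt with h | h
  · rw [mul_comm]
    exact ho j _ (by rw [hdeg]; exact_mod_cast h)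
  · exact ho i _ (by rw [hdeg]; exact_mod_cast h)

theorem map_sum_mul (hm : ∀ n, (S n).Monic) (hd : ∀ n, (S n).natDegree = n)
    (ho : ∀ (n : ℕ) (f : ℝ[X]), f.degree < n → c (S n * f) = 0) (s : Finset ℕ) (a : ℕ → ℝ)
    {i : ℕ} (hi : i ∈ s) : c ((∑ j ∈ s, a j • S j) * S i) = a i * c (S i ^ 2) := by
  rw [Finset.sum_mul, map_sum, Finset.sum_eq_single_of_mem i hi]
  · rw [smul_mul_assoc, map_smul, smul_eq_mul, sq]
  · intro j _ hj
    rw [smul_mul_assoc, map_smul, map_mul_eq_zero_of_ne hm hd ho hj, smul_zero]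

theorem map_sum_sq (hm : ∀ n, (S n).Monic) (hd : ∀ n, (S n).natDegree = n)
    (ho : ∀ (n : ℕ) (f : ℝ[X]), f.degree < n → c (S n * f) = 0) (s : Finset ℕ) (a : ℕ → ℝ) :
    c ((∑ j ∈ s, a j • S j) ^ 2) = ∑ j ∈ s, a j ^ 2 * c (S j ^ 2) := by
  rw [sq]
  conv_lhs => rw [Finset.mul_sum, map_sum]
  refine Finset.sum_congr rfl fun i hi => ?_
  rw [mul_smul_comm, map_smul, map_sum_mul hm hd ho s a hi, smul_eq_mul]
  ring

/-- Uniqueness of the monic orthogonal polynomials. -/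
theorem monicOP_eq (hm : ∀ n, (S n).Monic) (hd : ∀ n, (S n).natDegree = n)
    (ho : ∀ (n : ℕ) (f : ℝ[X]), f.degree < n → c (S n * f) = 0) (hne : ∀ n, c (S n ^ 2) ≠ 0)
    (n : ℕ) : monicOP c n = S n := by
  induction n using Nat.strong_induction_on with
  | _ n ih =>
    have hlt : (X ^ n - S n).degree < (n : WithBot ℕ) := by
      have hX : (X ^ n : ℝ[X]).degree = n := degree_X_pow n
      rw [← hX]
      refine degree_sub_lt_left ?_ (pow_ne_zero _ X_ne_zero) ?_
      · rw [hX, degree_eq_natDegree (hm n).ne_zero, hd]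
      · rw [(monic_X_pow n).leadingCoeff, (hm n).leadingCoeff]
    obtain ⟨a, ha⟩ := exists_eq_sum_of_monic hm hd n _ hlt
    rw [monicOP, Fin.sum_univ_eq_sum_range
      (fun i => C (c (X ^ n * monicOP c i) / c (monicOP c i ^ 2)) * monicOP c i) n]
    have : ∑ i ∈ Finset.range n, C (c (X ^ n * monicOP c i) / c (monicOP c i ^ 2)) * monicOP c i
        = X ^ n - S n := by
      rw [ha]
      refine Finset.sum_congr rfl fun i hi => ?_
      have hi' := Finset.mem_range.1 hi
      rw [ih i hi', ← smul_eq_C_mul, eq_add_of_sub_eq ha, add_mul, map_add,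
        map_sum_mul hm hd ho _ a hi, map_mul_eq_zero_of_ne hm hd ho hi'.ne', add_zero,
        mul_div_cancel_right₀ _ (hne i)]
    rw [this, sub_sub_cancel]

end Orthogonal

/-! ### Laguerre polynomials -/

/-- The operator `g ↦ g - g'`. -/
noncomputable def oneSubD : Module.End ℝ ℝ[X] := 1 - derivative

theorem oneSubD_apply (g : ℝ[X]) : oneSubD g = g - derivative g := rfl

/-- The monic Laguerre polynomials, by the Rodrigues formula. -/
noncomputable def lag (n : ℕ) : ℝ[X] := (oneSubD ^ n) (X ^ n)

theorem oneSubD_pow_succ_apply (k : ℕ) (g : ℝ[X]) :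
    (oneSubD ^ (k + 1)) g = oneSubD ((oneSubD ^ k) g) := by
  rw [pow_succ', Module.End.mul_apply]

theorem derivative_oneSubD_pow (k : ℕ) (g : ℝ[X]) :
    derivative ((oneSubD ^ k) g) = (oneSubD ^ k) (derivative g) := by
  induction k with
  | zero => simp
  | succ k ih =>
    rw [oneSubD_pow_succ_apply, oneSubD_pow_succ_apply, ← ih, oneSubD_apply, oneSubD_apply,
      derivative_sub]

/-- Each application of `1 - D` lowers the order of vanishing at 0 by at most one. This removes the
boundary terms in the repeated integration by parts below. -/
theorem X_pow_dvd_oneSubD_pow (k m : ℕ) : X ^ m ∣ (oneSubD ^ k) (X ^ (m + k) : ℝ[X]) := by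
  induction k generalizing m with
  | zero => simp
  | succ k ih =>
    obtain ⟨h, hh⟩ := ih (m + 1)
    rw [oneSubD_pow_succ_apply, show m + (k + 1) = m + 1 + k by ring, hh, oneSubD_apply,
      derivative_mul, derivative_X_pow]
    refine ⟨X * h - (C ((m + 1 : ℕ) : ℝ) * h + X * derivative h), ?_⟩
    rw [Nat.add_sub_cancel]
    ring

/-- As `(g - g') e^{-x} = -(g e^{-x})'`, the operator `1 - D` is the adjoint of `D` for `c₁`, up to
a boundary term at 0. -/
theorem c1Lin_mul_oneSubD (f g : ℝ[X]) :
    c1Lin (f * oneSubD g) = f.eval 0 * g.eval 0 + c1Lin (derivative f * g) := by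
  have h := c1Lin_derivative (f * g)
  rw [derivative_mul, map_add, eval_mul] at h
  rw [oneSubD_apply, mul_sub, map_sub]
  linarith

theorem c1Lin_mul_oneSubD_pow (k m : ℕ) (f : ℝ[X]) :
    c1Lin (f * (oneSubD ^ k) (X ^ (m + k))) = c1Lin (derivative^[k] f * X ^ (m + k)) := by
  induction k generalizing f m with
  | zero => simp
  | succ k ih =>
    have h0 : ((oneSubD ^ k) (X ^ (m + 1 + k) : ℝ[X])).eval 0 = 0 := by
      obtain ⟨h, hh⟩ := X_pow_dvd_oneSubD_pow k (m + 1)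
      simp [hh]
    rw [oneSubD_pow_succ_apply, c1Lin_mul_oneSubD, show m + (k + 1) = m + 1 + k by ring, h0, ih]
    simp

theorem c1Lin_lag_mul (n : ℕ) (f : ℝ[X]) :
    c1Lin (lag n * f) = c1Lin (derivative^[n] f * X ^ n) := by
  rw [mul_comm, lag]
  simpa using c1Lin_mul_oneSubD_pow n 0 f

theorem monic_oneSubD {g : ℝ[X]} (hg : g.Monic) : (oneSubD g).Monic :=
  hg.sub_of_left (degree_derivative_lt hg.ne_zero)

theorem natDegree_oneSubD {g : ℝ[X]} (hg : g.Monic) : (oneSubD g).natDegree = g.natDegree :=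
  natDegree_eq_of_degree_eq (degree_sub_eq_left_of_degree_lt (degree_derivative_lt hg.ne_zero))

theorem monic_natDegree_oneSubD_pow (k n : ℕ) :
    ((oneSubD ^ k) (X ^ n : ℝ[X])).Monic ∧ ((oneSubD ^ k) (X ^ n : ℝ[X])).natDegree = n := by
  induction k with
  | zero => simp [monic_X_pow]
  | succ k ih =>
    rw [oneSubD_pow_succ_apply]
    exact ⟨monic_oneSubD ih.1, (natDegree_oneSubD ih.1).trans ih.2⟩

theorem lag_monic (n : ℕ) : (lag n).Monic := (monic_natDegree_oneSubD_pow n n).1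

theorem lag_natDegree (n : ℕ) : (lag n).natDegree = n := (monic_natDegree_oneSubD_pow n n).2

theorem lag_degree (n : ℕ) : (lag n).degree = n := by
  rw [degree_eq_natDegree (lag_monic n).ne_zero, lag_natDegree]

theorem c1Lin_lag_mul_of_degree_lt (n : ℕ) (f : ℝ[X]) (hf : f.degree < n) :
    c1Lin (lag n * f) = 0 := by
  have : derivative^[n] f = 0 := by
    rcases eq_or_ne f 0 with rfl | h0
    · simp
    · exact iterate_derivative_eq_zero ((natDegree_lt_iff_degree_lt h0).2 hf)
  rw [c1Lin_lag_mul, this, zero_mul, map_zero]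

theorem c1Lin_lag_sq (n : ℕ) : c1Lin (lag n ^ 2) = (n.factorial : ℝ) ^ 2 := by
  have h : derivative^[n] (lag n) = C (n.factorial : ℝ) := by
    rw [eq_C_of_natDegree_eq_zero (p := derivative^[n] (lag n))]
    · have h1 : (lag n).coeff n = 1 := by
        have := lag_monic n
        rwa [Monic, leadingCoeff, lag_natDegree] at this
      rw [coeff_iterate_derivative]
      simp [h1, Nat.descFactorial_self]
    · have := natDegree_iterate_derivative (lag n) n
      rw [lag_natDegree] at this
      omega
  rw [sq, c1Lin_lag_mul, h, ← smul_eq_C_mul, map_smul, c1Lin_X_pow, smul_eq_mul, sq]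

/-- `D` commutes with `1 - D`, so it can be moved onto `X ^ (n + 1)` in the Rodrigues formula. -/
theorem derivative_lag_succ (n : ℕ) :
    derivative (lag (n + 1)) = ((n : ℝ) + 1) • (lag n - derivative (lag n)) := by
  rw [lag, derivative_oneSubD_pow, derivative_X_pow, ← smul_eq_C_mul, map_smul,
    oneSubD_pow_succ_apply, Nat.add_sub_cancel, ← lag, oneSubD_apply]
  push_cast
  rfl

theorem lag_zero : lag 0 = 1 := by simp [lag]

theorem eval_zero_lag_succ (n : ℕ) :
    (lag (n + 1)).eval 0 = -((n : ℝ) + 1) * (lag n).eval 0 := by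
  have h1 := c1Lin_derivative (lag (n + 1))
  have h2 := c1Lin_lag_mul_of_degree_lt (n + 1) 1 (by
    rw [degree_one]; exact_mod_cast Nat.succ_pos n)
  rw [mul_one] at h2
  rw [derivative_lag_succ, map_smul, map_sub, c1Lin_derivative, h2, smul_eq_mul] at h1
  linarith

theorem eval_zero_derivative_lag (n : ℕ) :
    (derivative (lag n)).eval 0 = -(n : ℝ) * (lag n).eval 0 := by
  induction n with
  | zero => simp [lag_zero]
  | succ n ih =>
    rw [derivative_lag_succ, eval_smul, eval_sub, ih, eval_zero_lag_succ, smul_eq_mul]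
    push_cast
    ring

theorem T_eq (n : ℕ) : T n = lag n :=
  monicOP_eq (c := c1Lin) lag_monic lag_natDegree c1Lin_lag_mul_of_degree_lt
    (fun n => by rw [c1Lin_lag_sq]; positivity) n

theorem k1_eq (n : ℕ) : k1 n = (n.factorial : ℝ) ^ 2 := by
  rw [k1, T_eq]
  exact c1Lin_lag_sq n

/-! ### The orthogonal polynomials of `c₀` -/

/-- `b t = 1 + M t`. -/
def b (M t : ℝ) : ℝ := 1 + M * t

/-- The monic orthogonal polynomials of `c₀` in terms of Laguerre polynomials. -/
noncomputable def lagD (M : ℝ) (n : ℕ) : ℝ[X] := lag n + (M / b M n) • derivative (lag n)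

section LagD

variable {M : ℝ}

theorem b_pos (hM : 0 ≤ M) {t : ℝ} (ht : 0 ≤ t) : 0 < b M t := by
  unfold b
  positivity

theorem degree_smul_derivative_lag_lt (a : ℝ) (n : ℕ) :
    (a • derivative (lag n)).degree < (n : WithBot ℕ) := by
  refine (degree_smul_le _ _).trans_lt ?_
  rw [← lag_degree n]
  exact degree_derivative_lt (lag_monic n).ne_zero

theorem lagD_monic (M : ℝ) (n : ℕ) : (lagD M n).Monic :=
  (lag_monic n).add_of_left (by rw [lag_degree]; exact degree_smul_derivative_lag_lt _ n)

theorem lagD_natDegree (M : ℝ) (n : ℕ) : (lagD M n).natDegree = n := by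
  rw [← lag_natDegree n]
  refine natDegree_eq_of_degree_eq ?_
  rw [lag_natDegree]
  exact degree_add_eq_left_of_degree_lt
    (by rw [lag_degree]; exact degree_smul_derivative_lag_lt _ n)

theorem eval_zero_lagD (hM : 0 ≤ M) (n : ℕ) :
    (lagD M n).eval 0 = (lag n).eval 0 / b M n := by
  have := (b_pos hM n.cast_nonneg).ne'
  rw [lagD, eval_add, eval_smul, eval_zero_derivative_lag, smul_eq_mul]
  field_simp
  unfold b
  ring

theorem c1Lin_derivative_lag_mul (n : ℕ) (f : ℝ[X]) (hf : f.natDegree ≤ n) :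
    c1Lin (derivative (lag n) * f) = c1Lin (lag n * f) - (lag n).eval 0 * f.eval 0 := by
  have h := c1Lin_derivative (lag n * f)
  have h0 : c1Lin (lag n * derivative f) = 0 := by
    rcases eq_or_ne (derivative f) 0 with h | h
    · simp [h]
    · refine c1Lin_lag_mul_of_degree_lt n _ ((degree_derivative_lt ?_).trans_le ?_)
      · rintro rfl
        simp at h
      · exact degree_le_of_natDegree_le hf
  rw [derivative_mul, map_add, eval_mul, h0] at h
  linarith

/-- The coefficient `M / b_n` in `lagD` is chosen so that the point mass cancels the boundary term
`(lag n)(0) f(0)` of the integration by parts. Allowing degree `n` for `f` gives both the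
orthogonality and the norm. -/
theorem c0Lin_lagD_mul (hM : 0 ≤ M) (n : ℕ) (f : ℝ[X]) (hf : f.natDegree ≤ n) :
    c0Lin M (lagD M n * f) = b M (n + 1) / b M n * c1Lin (lag n * f) := by
  have := (b_pos hM n.cast_nonneg).ne'
  rw [c0Lin_apply, eval_mul, eval_zero_lagD hM, lagD, add_mul, map_add, smul_mul_assoc, map_smul,
    c1Lin_derivative_lag_mul n f hf, smul_eq_mul]
  field_simp
  unfold b
  ring

theorem c0Lin_lagD_mul_of_degree_lt (hM : 0 ≤ M) (n : ℕ) (f : ℝ[X]) (hf : f.degree < n) :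
    c0Lin M (lagD M n * f) = 0 := by
  rw [c0Lin_lagD_mul hM n f (natDegree_le_of_degree_le hf.le), c1Lin_lag_mul_of_degree_lt n f hf,
    mul_zero]

theorem c0Lin_lagD_sq (hM : 0 ≤ M) (n : ℕ) :
    c0Lin M (lagD M n ^ 2) = (n.factorial : ℝ) ^ 2 * (b M (n + 1) / b M n) := by
  rw [sq, c0Lin_lagD_mul hM n _ (lagD_natDegree M n).le]
  conv_lhs => rw [lagD]
  rw [mul_add, map_add, ← sq, c1Lin_lag_sq,
    c1Lin_lag_mul_of_degree_lt n _ (degree_smul_derivative_lag_lt _ n), add_zero, mul_comm]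

theorem P_eq (hM : 0 ≤ M) (n : ℕ) : P M n = lagD M n := by
  refine monicOP_eq (c := c0Lin M) (lagD_monic M) (lagD_natDegree M)
    (c0Lin_lagD_mul_of_degree_lt hM) (fun n => ?_) n
  rw [c0Lin_lagD_sq hM]
  have := b_pos hM n.cast_nonneg
  have := b_pos hM (t := n + 1) (by positivity)
  positivity

theorem k0_eq (hM : 0 ≤ M) (n : ℕ) :
    k0 M n = (n.factorial : ℝ) ^ 2 * (b M (n + 1) / b M n) := by
  rw [k0, P_eq hM]
  exact c0Lin_lagD_sq hM n

/-- The coherence relation. -/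
theorem lag_eq_derivative_lagD (hM : 0 ≤ M) (n : ℕ) :
    lag n = (1 / ((n : ℝ) + 1)) • derivative (lagD M (n + 1))
      + (b M n / b M (n + 1)) • derivative (lagD M n) := by
  have h0 := (b_pos hM n.cast_nonneg).ne'
  have h1 := (b_pos hM (t := n + 1) (by positivity)).ne'
  have h2 : (n : ℝ) + 1 ≠ 0 := by positivity
  simp only [lagD, derivative_add, derivative_smul, derivative_lag_succ, derivative_sub]
  push_cast
  have e : b M (n + 1) = b M n + M := by unfold b; ring
  match_scalars
  · field_simp
  · field_simp
    rw [e]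
    ring
  · field_simp
    ring

theorem σ_eq (hM : 0 ≤ M) {n : ℕ} (hn : 1 ≤ n) : σ M n = -(n * (b M n / b M (n + 1))) := by
  have h := lag_eq_derivative_lagD hM n
  obtain ⟨m, rfl⟩ : ∃ m, n = m + 1 := ⟨n - 1, by omega⟩
  have hc : (lagD M (m + 1)).coeff (m + 1) = 1 := by
    have := lagD_monic M (m + 1)
    rwa [Monic, leadingCoeff, lagD_natDegree] at this
  rw [σ, P_eq hM, T_eq, ← smul_eq_C_mul]
  rw [h]
  rw [sub_add_cancel_left, coeff_neg, coeff_smul, coeff_derivative, Nat.add_sub_cancel, hc]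
  push_cast
  rw [smul_eq_mul]
  ring

theorem isCoherent (hM : 0 ≤ M) : IsCoherent M := by
  intro n hn
  have h0 := b_pos hM n.cast_nonneg
  have h1 := b_pos hM (t := n + 1) (by positivity)
  have hn0 : (n : ℝ) ≠ 0 := by positivity
  rw [σ_eq hM hn]
  refine ⟨neg_ne_zero.2 (by positivity), ?_⟩
  rw [T_eq, P_eq hM, P_eq hM, ← smul_eq_C_mul, ← smul_eq_C_mul, neg_div,
    mul_div_cancel_left₀ _ hn0, neg_smul, sub_neg_eq_add]
  exact lag_eq_derivative_lagD hM n

/-! ### The entries of the matrix -/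

theorem q0_eq (hM : 0 ≤ M) {j : ℕ} (hj : 1 ≤ j) : q0 M j = b M (j + 1) / b M j := by
  obtain ⟨m, rfl⟩ : ∃ m, j = m + 1 := ⟨j - 1, by omega⟩
  have h0 := (b_pos hM (m + 1).cast_nonneg).ne'
  have hf : (m.factorial : ℝ) ≠ 0 := by positivity
  have h2 : (m : ℝ) + 1 ≠ 0 := by positivity
  rw [q0, k0_eq hM, k1_eq, Nat.add_sub_cancel, Nat.factorial_succ]
  push_cast at h0 ⊢
  field_simp

theorem e0_eq (hM : 0 ≤ M) {n j : ℕ} (hj : 1 ≤ j) (hjn : j < n) :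
    e0 M n j = b M j / b M (j + 1) := by
  have h0 := (b_pos hM j.cast_nonneg).ne'
  have h1 := (b_pos hM (t := j + 1) (by positivity)).ne'
  have hf : (j.factorial : ℝ) ≠ 0 := by positivity
  have h2 : (j : ℝ) ≠ 0 := by positivity
  rw [e0, if_pos ⟨hj, hjn⟩, σ_eq hM hj, k0_eq hM, k1_eq]
  field_simp

theorem e0_self (M : ℝ) (n : ℕ) : e0 M n n = 0 := if_neg (by omega)

theorem e0_zero (M : ℝ) (n : ℕ) : e0 M n 0 = 0 := if_neg (by omega)

theorem offDiag_eq (hM : 0 ≤ M) (i : ℕ) : offDiag M (i + 1) = 1 := by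
  have h0 := (b_pos hM (i + 1).cast_nonneg).ne'
  have h1 := (b_pos hM (t := (i + 1 : ℕ) + 1) (by positivity)).ne'
  have hf : (i.factorial : ℝ) ≠ 0 := by positivity
  have h2 : (i : ℝ) + 1 ≠ 0 := by positivity
  have hs : Real.sqrt (k1 (i + 1 - 1) * k1 (i + 1)) = i.factorial * (i + 1).factorial := by
    rw [k1_eq, k1_eq, ← mul_pow, Nat.add_sub_cancel, Real.sqrt_sq (by positivity)]
  rw [offDiag, hs, σ_eq hM (by omega), k0_eq hM, Nat.factorial_succ]
  push_cast at h0 h1 ⊢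
  field_simp

end LagD


/-! ### The qd algorithm -/

section QD

variable {M : ℝ}

/-- `∑_{k ≤ t} b_k²`, in closed form. -/
noncomputable def sumSqB (M t : ℝ) : ℝ :=
  t * (1 + M * (t + 1) + M ^ 2 / 6 * (t + 1) * (2 * t + 1))

/-- `b_{t+1} ∑_{k ≤ t} (sumSqB k)² / (b_k b_{k+1})`, in closed form. -/
noncomputable def sumSqS (M t : ℝ) : ℝ :=
  t * (t + 1) * (2 * t + 1) / 30 * (5 + 5 * M * (t + 2) + M ^ 2 * (t + 2) * (2 * t + 3)
    + M ^ 3 / 6 * (t + 1) * (t + 2) * (2 * t + 3))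

theorem sumSqB_pos (hM : 0 ≤ M) {t : ℝ} (ht : 0 < t) : 0 < sumSqB M t := by
  unfold sumSqB
  positivity

theorem sumSqS_pos (hM : 0 ≤ M) {t : ℝ} (ht : 0 < t) : 0 < sumSqS M t := by
  unfold sumSqS
  positivity

theorem sumSqB_add_one (M t : ℝ) : sumSqB M (t + 1) = sumSqB M t + b M (t + 1) ^ 2 := by
  unfold sumSqB b
  ring

theorem b_mul_sumSqS_add_one (M t : ℝ) :
    b M (t + 1) * sumSqS M (t + 1) = b M (t + 2) * sumSqS M t + sumSqB M (t + 1) ^ 2 := by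
  unfold sumSqB sumSqS b
  ring

theorem sum_b_sq (M : ℝ) (n : ℕ) :
    ∑ i ∈ Finset.range n, b M (i + 1) ^ 2 = sumSqB M n := by
  induction n with
  | zero => simp [sumSqB]
  | succ n ih =>
    rw [Finset.sum_range_succ, ih]
    push_cast
    rw [sumSqB_add_one]

theorem sum_sumSqB_sq (hM : 0 ≤ M) (n : ℕ) :
    ∑ i ∈ Finset.range n, sumSqB M (i + 1) ^ 2 / (b M (i + 1) * b M (i + 2))
      = sumSqS M n / b M (n + 1) := by
  induction n with
  | zero => simp [sumSqS]
  | succ n ih =>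
    have h1 := (b_pos hM (t := n + 1) (by positivity)).ne'
    have h2 := (b_pos hM (t := n + 2) (by positivity)).ne'
    rw [Finset.sum_range_succ, ih]
    push_cast
    rw [show (n : ℝ) + 1 + 1 = n + 2 by ring]
    field_simp
    rw [mul_comm, b_mul_sumSqS_add_one]

/-- Below the last index the value does not depend on `n`; at the last index `e_n = 0` changes it,
hence the separate formula in `qd_one_Q_self`. The second qd step splits in the same way. -/
theorem qd_one_Q_of_lt (hM : 0 ≤ M) {n : ℕ} (j : ℕ) (hj : j + 1 < n) :
    qdStepQ (q0 M) (e0 M n) (j + 1)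
      = sumSqB M (j + 2) * b M (j + 1) / (b M (j + 2) * sumSqB M (j + 1)) := by
  induction j with
  | zero =>
    rw [qdStepQ, q0_eq hM le_rfl, e0_eq hM le_rfl hj]
    have h1 := (b_pos hM (t := 1) (by positivity)).ne'
    have h2 := (b_pos hM (t := 2) (by positivity)).ne'
    have hB1 : sumSqB M 1 = b M 1 ^ 2 := by unfold sumSqB b; ring
    have hB2 : sumSqB M 2 = b M 1 ^ 2 + b M 2 ^ 2 := by unfold sumSqB b; ring
    have e2 : (1 : ℝ) + 1 = 2 := by norm_num
    simp only [Nat.cast_one, Nat.cast_zero, zero_add, e2, hB1, hB2]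
    field_simp
    ring
  | succ j ih =>
    rw [qdStepQ, ih (by omega), q0_eq hM (by omega), e0_eq hM (by omega) hj,
      e0_eq hM (by omega) (by omega)]
    push_cast
    have e2 : (j : ℝ) + 1 + 1 = j + 2 := by ring
    have e3 : (j : ℝ) + 2 + 1 = j + 3 := by ring
    have e4 : (j : ℝ) + 1 + 2 = j + 3 := by ring
    have hB2 := sumSqB_add_one M (j + 1)
    have hB3 := sumSqB_add_one M (j + 2)
    simp only [e2, e3, e4] at *
    have h1 := (b_pos hM (t := j + 1) (by positivity)).ne'
    have h2 := (b_pos hM (t := j + 2) (by positivity)).ne'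
    have h3 := (b_pos hM (t := j + 3) (by positivity)).ne'
    have h4 := (sumSqB_pos hM (t := j + 1) (by positivity)).ne'
    have h5 := (sumSqB_pos hM (t := j + 2) (by positivity)).ne'
    rw [hB3]
    field_simp
    rw [hB2]
    ring

theorem qd_one_Q_self (hM : 0 ≤ M) (n : ℕ) :
    qdStepQ (q0 M) (e0 M (n + 1)) (n + 1) = b M (n + 2) * b M (n + 1) / sumSqB M (n + 1) := by
  cases n with
  | zero =>
    rw [qdStepQ, e0_self, q0_eq hM le_rfl]
    have h1 := (b_pos hM (t := 1) (by positivity)).ne'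
    have hB1 : sumSqB M 1 = b M 1 ^ 2 := by unfold sumSqB b; ring
    have e2 : (1 : ℝ) + 1 = 2 := by norm_num
    simp only [Nat.cast_one, Nat.cast_zero, zero_add, e2, hB1]
    field_simp
    ring
  | succ j =>
    rw [qdStepQ, qd_one_Q_of_lt hM j (by omega), q0_eq hM (by omega), e0_self,
      e0_eq hM (by omega) (by omega)]
    push_cast
    have e2 : (j : ℝ) + 1 + 1 = j + 2 := by ring
    have e3 : (j : ℝ) + 2 + 1 = j + 3 := by ring
    have e4 : (j : ℝ) + 1 + 2 = j + 3 := by ring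
    have hB2 := sumSqB_add_one M (j + 1)
    simp only [e2, e3, e4] at *
    have h1 := (b_pos hM (t := j + 1) (by positivity)).ne'
    have h2 := (b_pos hM (t := j + 2) (by positivity)).ne'
    have h4 := (sumSqB_pos hM (t := j + 1) (by positivity)).ne'
    have h5 := (sumSqB_pos hM (t := j + 2) (by positivity)).ne'
    field_simp
    rw [hB2]
    ring

theorem qd_one_E_of_lt (hM : 0 ≤ M) {n : ℕ} (j : ℕ) (hj : j + 1 < n) :
    qdStepE (q0 M) (e0 M n) (j + 1)
      = b M (j + 3) * sumSqB M (j + 1) / (b M (j + 2) * sumSqB M (j + 2)) := by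
  rw [qdStepE, qd_one_Q_of_lt hM j hj, q0_eq hM (by omega), e0_eq hM (by omega) hj]
  push_cast
  have e2 : (j : ℝ) + 1 + 1 = j + 2 := by ring
  have e3 : (j : ℝ) + 2 + 1 = j + 3 := by ring
  simp only [e2, e3]
  have h1 := (b_pos hM (t := j + 1) (by positivity)).ne'
  have h2 := (b_pos hM (t := j + 2) (by positivity)).ne'
  have h4 := (sumSqB_pos hM (t := j + 1) (by positivity)).ne'
  have h5 := (sumSqB_pos hM (t := j + 2) (by positivity)).ne'
  field_simp

theorem qd_one_E_self (M : ℝ) (n : ℕ) : qdStepE (q0 M) (e0 M n) n = 0 := by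
  rw [qdStepE, e0_self, mul_zero, zero_div]

theorem qd_two_Q_of_lt (hM : 0 ≤ M) {n : ℕ} (j : ℕ) (hj : j + 1 < n) :
    qdStepQ (qdStepQ (q0 M) (e0 M n)) (qdStepE (q0 M) (e0 M n)) (j + 1)
      = sumSqS M (j + 2) * sumSqB M (j + 1) / (sumSqS M (j + 1) * sumSqB M (j + 2)) := by
  induction j with
  | zero =>
    rw [qdStepQ, qd_one_Q_of_lt hM 0 hj, qd_one_E_of_lt hM 0 hj]
    have h1 := (b_pos hM (t := 1) (by positivity)).ne'
    have h2 := (b_pos hM (t := 2) (by positivity)).ne'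
    have h4 := (sumSqB_pos hM (t := 1) (by positivity)).ne'
    have h5 := (sumSqB_pos hM (t := 2) (by positivity)).ne'
    have h6 := (sumSqS_pos hM (t := 1) (by positivity)).ne'
    have hB1 : sumSqB M 1 = b M 1 ^ 2 := by unfold sumSqB b; ring
    have hS1 : sumSqS M 1 = b M 1 ^ 3 := by unfold sumSqS b; ring
    have hS2 : b M 2 * sumSqS M 2 = b M 3 * b M 1 ^ 3 + sumSqB M 2 ^ 2 := by
      unfold sumSqS sumSqB b; ring
    simp only [Nat.cast_zero, zero_add, hB1, hS1] at *
    field_simp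
    linear_combination -hS2
  | succ j ih =>
    rw [qdStepQ, ih (by omega), qd_one_Q_of_lt hM (j + 1) hj, qd_one_E_of_lt hM (j + 1) hj,
      qd_one_E_of_lt hM j (by omega)]
    push_cast
    have e2 : (j : ℝ) + 1 + 1 = j + 2 := by ring
    have e3 : (j : ℝ) + 1 + 2 = j + 3 := by ring
    have e4 : (j : ℝ) + 1 + 3 = j + 4 := by ring
    have e5 : (j : ℝ) + 2 + 1 = j + 3 := by ring
    have e6 : (j : ℝ) + 2 + 2 = j + 4 := by ring
    have hS2 := b_mul_sumSqS_add_one M (j + 1)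
    have hS3 := b_mul_sumSqS_add_one M (j + 2)
    simp only [e2, e3, e4, e5, e6] at *
    have h2 := (b_pos hM (t := j + 2) (by positivity)).ne'
    have h3 := (b_pos hM (t := j + 3) (by positivity)).ne'
    have h4 := (sumSqB_pos hM (t := j + 1) (by positivity)).ne'
    have h5 := (sumSqB_pos hM (t := j + 2) (by positivity)).ne'
    have h6 := (sumSqB_pos hM (t := j + 3) (by positivity)).ne'
    have h7 := (sumSqS_pos hM (t := j + 1) (by positivity)).ne'
    have h8 := (sumSqS_pos hM (t := j + 2) (by positivity)).ne'
    field_simp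
    linear_combination sumSqB M (j + 3) ^ 2 * hS2 - sumSqB M (j + 2) ^ 2 * hS3

theorem qd_two_Q_self (hM : 0 ≤ M) (n : ℕ) :
    qdStepQ (qdStepQ (q0 M) (e0 M (n + 1))) (qdStepE (q0 M) (e0 M (n + 1))) (n + 1)
      = b M (n + 2) * sumSqB M (n + 1) / sumSqS M (n + 1) := by
  cases n with
  | zero =>
    rw [qdStepQ, qd_one_Q_self hM, qd_one_E_self]
    have h1 := (b_pos hM (t := 1) (by positivity)).ne'
    have hB1 : sumSqB M 1 = b M 1 ^ 2 := by unfold sumSqB b; ring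
    have hS1 : sumSqS M 1 = b M 1 ^ 3 := by unfold sumSqS b; ring
    simp only [Nat.cast_zero, zero_add, hB1, hS1]
    field_simp
    ring
  | succ j =>
    rw [qdStepQ, qd_one_Q_self hM, qd_one_E_self, qd_one_E_of_lt hM j (by omega),
      qd_two_Q_of_lt hM j (by omega)]
    push_cast
    have e2 : (j : ℝ) + 1 + 1 = j + 2 := by ring
    have e3 : (j : ℝ) + 1 + 2 = j + 3 := by ring
    have hS2 := b_mul_sumSqS_add_one M (j + 1)
    simp only [e2, e3] at *
    have h2 := (b_pos hM (t := j + 2) (by positivity)).ne'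
    have h4 := (sumSqB_pos hM (t := j + 1) (by positivity)).ne'
    have h5 := (sumSqB_pos hM (t := j + 2) (by positivity)).ne'
    have h7 := (sumSqS_pos hM (t := j + 1) (by positivity)).ne'
    have h8 := (sumSqS_pos hM (t := j + 2) (by positivity)).ne'
    field_simp
    linear_combination b M (j + 3) * hS2

theorem qdQ_two_self (hM : 0 ≤ M) {n : ℕ} (hn : 1 ≤ n) :
    qdQ M n 2 n = b M (n + 1) * sumSqB M n / sumSqS M n := by
  obtain ⟨m, rfl⟩ : ∃ m, n = m + 1 := ⟨n - 1, by omega⟩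
  have := qd_two_Q_self hM m
  push_cast
  rw [add_assoc, one_add_one_eq_two]
  exact this

theorem qdQ_two_self_eq_p1_div_p2 (hM : 0 ≤ M) {n : ℕ} (hn : 1 ≤ n) :
    qdQ M n 2 n = 30 * (1 + ((n : ℝ) + 1) * M) / (((n : ℝ) + 1) * (2 * (n : ℝ) + 1))
      * (p1 M ((n : ℝ) - 1) / p2 M ((n : ℝ) - 1)) := by
  have hn0 : (0 : ℝ) < n := by positivity
  have hS := sumSqS_pos hM hn0
  have e1 : sumSqB M n = n * p1 M (n - 1) := by unfold sumSqB p1; ring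
  have e2 : sumSqS M n = n * (n + 1) * (2 * n + 1) / 30 * p2 M (n - 1) := by
    unfold sumSqS p2; ring
  have hp : p2 M (n - 1) ≠ 0 := by
    intro h
    rw [e2, h, mul_zero] at hS
    exact hS.false
  rw [qdQ_two_self hM hn, e1, e2, b]
  field_simp

end QD

/-! ### Least eigenvalues -/

section Matrix

open Matrix

variable {n : ℕ}

theorem eval_charpoly_eq_zero_iff (K : Matrix (Fin n) (Fin n) ℝ) (t : ℝ) :
    K.charpoly.eval t = 0 ↔ ∃ v, v ≠ 0 ∧ K *ᵥ v = t • v := by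
  rw [Matrix.eval_charpoly, ← Matrix.exists_mulVec_eq_zero_iff]
  refine exists_congr fun v => and_congr_right fun _ => ?_
  rw [Matrix.sub_mulVec, sub_eq_zero, eq_comm]
  simp

theorem posSemidef_sub_of_mem_lowerBounds {K : Matrix (Fin n) (Fin n) ℝ} (hK : K.IsHermitian)
    {m : ℝ} (hm : m ∈ lowerBounds {x | K.charpoly.eval x = 0}) :
    (K - m • (1 : Matrix (Fin n) (Fin n) ℝ)).PosSemidef := by
  have hK' : (K - m • (1 : Matrix (Fin n) (Fin n) ℝ)).IsHermitian :=
    hK.sub (by simp [Matrix.IsHermitian])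
  rw [hK'.posSemidef_iff_eigenvalues_nonneg]
  intro i
  have h := hK'.mulVec_eigenvectorBasis i
  -- An eigenvalue `ν` of `K - m` yields the root `ν + m` of the characteristic polynomial of `K`,
  -- so `m ≤ ν + m`.
  rw [Matrix.sub_mulVec, Matrix.smul_mulVec, Matrix.one_mulVec, sub_eq_iff_eq_add, ← add_smul] at h
  have := hm ((eval_charpoly_eq_zero_iff K _).2 ⟨_, fun h0 => ?_, h⟩)
  · simpa using this
  · exact hK'.eigenvectorBasis.toBasis.ne_zero i (by
      rw [OrthonormalBasis.coe_toBasis]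
      ext j
      exact congrFun h0 j)

theorem isLeast_sInf_charpoly_roots (hn : 1 ≤ n) {K : Matrix (Fin n) (Fin n) ℝ}
    (hK : K.IsHermitian) :
    IsLeast {x | K.charpoly.eval x = 0} (sInf {x | K.charpoly.eval x = 0}) := by
  have hfin : {x | K.charpoly.eval x = 0}.Finite := by
    refine (Polynomial.finite_setOfPred_isRoot K.charpoly_monic.ne_zero).subset fun x hx => hx
  have hne : {x | K.charpoly.eval x = 0}.Nonempty := by
    have h := hK.mulVec_eigenvectorBasis ⟨0, hn⟩
    refine ⟨_, (eval_charpoly_eq_zero_iff K _).2 ⟨_, fun h0 => ?_, h⟩⟩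
    exact hK.eigenvectorBasis.toBasis.ne_zero ⟨0, hn⟩ (by
      rw [OrthonormalBasis.coe_toBasis]
      ext j
      exact congrFun h0 j)
  exact ⟨hne.csInf_mem hfin, fun x hx => csInf_le hfin.bddBelow hx⟩

/-- `R Rᵀ` and `Rᵀ R` have the same characteristic polynomial, so `Rᵀ R - m` is positive
semidefinite. Equality in its quadratic form puts `s` in its kernel. -/
theorem mul_dotProduct_le_of_mem_lowerBounds {R : Matrix (Fin n) (Fin n) ℝ} {m : ℝ}
    (hm : m ∈ lowerBounds {x | (R * Rᵀ).charpoly.eval x = 0}) (s : Fin n → ℝ) :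
    m * (s ⬝ᵥ s) ≤ (R *ᵥ s) ⬝ᵥ (R *ᵥ s) ∧
      (m * (s ⬝ᵥ s) = (R *ᵥ s) ⬝ᵥ (R *ᵥ s) → Rᵀ *ᵥ (R *ᵥ s) = m • s) := by
  rw [Matrix.charpoly_mul_comm] at hm
  have h := posSemidef_sub_of_mem_lowerBounds (K := Rᵀ * R)
    (by simpa using Matrix.isHermitian_conjTranspose_mul_self R) hm
  have e : star s ⬝ᵥ ((Rᵀ * R - m • (1 : Matrix (Fin n) (Fin n) ℝ)) *ᵥ s)
      = (R *ᵥ s) ⬝ᵥ (R *ᵥ s) - m * (s ⬝ᵥ s) := by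
    rw [Matrix.sub_mulVec, Matrix.smul_mulVec, Matrix.one_mulVec, dotProduct_sub, dotProduct_smul,
      ← Matrix.mulVec_mulVec, Matrix.dotProduct_mulVec, Matrix.vecMul_transpose]
    simp
  constructor
  · have := h.dotProduct_mulVec_nonneg s
    linarith
  · intro heq
    have := (h.dotProduct_mulVec_zero_iff s).1 (by rw [e, heq, sub_self])
    rw [Matrix.sub_mulVec, Matrix.smul_mulVec, Matrix.one_mulVec, sub_eq_zero] at this
    rw [Matrix.mulVec_mulVec, this]

end Matrix

/-! ### The bidiagonal factor -/

section Bidiagonal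

open Matrix

variable {M : ℝ}

/-- The square root of `q_{i+1}^{(0)}`. -/
noncomputable def β (M : ℝ) (i : ℕ) : ℝ := Real.sqrt (b M (i + 2) / b M (i + 1))

theorem β_pos (hM : 0 ≤ M) (i : ℕ) : 0 < β M i :=
  Real.sqrt_pos.2 (div_pos (b_pos hM (by positivity)) (b_pos hM (by positivity)))

theorem β_sq (hM : 0 ≤ M) (i : ℕ) : β M i ^ 2 = b M (i + 2) / b M (i + 1) :=
  Real.sq_sqrt (div_pos (b_pos hM (by positivity)) (b_pos hM (by positivity))).le

/-- The lower bidiagonal Cholesky factor of `Ktilde`. -/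
noncomputable def bidiag (M : ℝ) (n : ℕ) : Matrix (Fin n) (Fin n) ℝ :=
  Matrix.of fun i j =>
    (if (i : ℕ) = j then β M j else 0) + (if (i : ℕ) = j + 1 then 1 / β M j else 0)

/-- Vectors are sequences on `ℕ`; the convention `v n = 0` lets the last coordinate follow the
general formula. -/
theorem bidiag_transpose_mulVec (M : ℝ) (n : ℕ) (v : ℕ → ℝ) (hv : v n = 0) (j : Fin n) :
    ((bidiag M n)ᵀ *ᵥ fun i => v i) j = β M j * v j + v (j + 1) / β M j := by
  have : ((bidiag M n)ᵀ *ᵥ fun i => v i) j = ∑ i ∈ Finset.range n,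
      ((if i = (j : ℕ) then β M j else 0) + (if i = j + 1 then 1 / β M j else 0)) * v i := by
    rw [← Fin.sum_univ_eq_sum_range (fun i =>
      ((if i = (j : ℕ) then β M j else 0) + (if i = j + 1 then 1 / β M j else 0)) * v i)]
    rfl
  rw [this]
  simp only [add_mul, Finset.sum_add_distrib, ite_mul, zero_mul, Finset.sum_ite_eq',
    Finset.mem_range, j.isLt, if_true]
  split_ifs with h
  · ring
  · rw [show (j : ℕ) + 1 = n by omega, hv]
    ring

theorem bidiag_mulVec_zero (M : ℝ) {n : ℕ} (s : ℕ → ℝ) (i : Fin n) (hi : (i : ℕ) = 0) :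
    (bidiag M n *ᵥ fun j => s j) i = β M 0 * s 0 := by
  have : (bidiag M n *ᵥ fun j => s j) i = ∑ j ∈ Finset.range n,
      ((if (i : ℕ) = j then β M j else 0) + (if (i : ℕ) = j + 1 then 1 / β M j else 0)) * s j := by
    rw [← Fin.sum_univ_eq_sum_range (fun j =>
      ((if (i : ℕ) = j then β M j else 0) + (if (i : ℕ) = j + 1 then 1 / β M j else 0)) * s j)]
    rfl
  rw [this, hi, Finset.sum_eq_single_of_mem 0 (Finset.mem_range.2 (by omega))]
  · simp
  · intro j _ hj
    simp [hj.symm]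

theorem bidiag_mulVec_succ (M : ℝ) {n : ℕ} (s : ℕ → ℝ) (i : Fin n) (k : ℕ)
    (hi : (i : ℕ) = k + 1) :
    (bidiag M n *ᵥ fun j => s j) i = β M (k + 1) * s (k + 1) + s k / β M k := by
  have : (bidiag M n *ᵥ fun j => s j) i = ∑ j ∈ Finset.range n,
      ((if (i : ℕ) = j then β M j else 0) + (if (i : ℕ) = j + 1 then 1 / β M j else 0)) * s j := by
    rw [← Fin.sum_univ_eq_sum_range (fun j =>
      ((if (i : ℕ) = j then β M j else 0) + (if (i : ℕ) = j + 1 then 1 / β M j else 0)) * s j)]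
    rfl
  rw [this, hi]
  simp only [add_mul, Finset.sum_add_distrib, ite_mul, zero_mul, Finset.sum_ite_eq,
    Finset.mem_range, add_left_inj]
  rw [if_pos (by omega), if_pos (by omega)]
  ring

theorem Ktilde_eq (hM : 0 ≤ M) (n : ℕ) : Ktilde M n = bidiag M n * (bidiag M n)ᵀ := by
  ext i j
  have hβ (i : ℕ) := (β_pos hM i).ne'
  -- `r` is row `j` of `bidiag`, extended to `ℕ`, so that the formulas for `bidiag *ᵥ` compute the
  -- product entrywise.
  obtain ⟨r, hr⟩ : ∃ r : ℕ → ℝ, r = fun k => (if (j : ℕ) = k then β M k else 0)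
    + (if (j : ℕ) = k + 1 then 1 / β M k else 0) := ⟨_, rfl⟩
  have hrow : (bidiag M n * (bidiag M n)ᵀ) i j = (bidiag M n *ᵥ fun k => r k) i := by
    rw [hr]
    rfl
  rw [hrow, Ktilde, Matrix.of_apply]
  obtain ⟨i, hi⟩ := i
  obtain ⟨j, hj⟩ := j
  cases i with
  | zero =>
    rw [bidiag_mulVec_zero M r ⟨0, hi⟩ rfl, hr]
    dsimp only
    rcases Nat.lt_trichotomy j 1 with h | rfl | h
    · obtain rfl : j = 0 := by omega
      have := β_sq hM 0
      simp [q0_eq hM, e0_zero]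
      rw [← sq, this]
      norm_num
    · simp [offDiag_eq hM 0, hβ]
    · simp [show j ≠ 0 by omega, show j ≠ 1 by omega, show 0 ≠ j by omega]
  | succ i =>
    rw [bidiag_mulVec_succ M r ⟨i + 1, hi⟩ i rfl, hr]
    dsimp only
    rcases eq_or_ne j (i + 1) with rfl | h1
    · have h := β_sq hM i
      have h' := β_sq hM (i + 1)
      rw [if_pos rfl, if_pos rfl, if_neg (by omega), if_neg (by omega), if_pos rfl,
        q0_eq hM (by omega), e0_eq hM (by omega) hi, add_zero, zero_add, div_div, ← sq, ← sq, h,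
        h', one_div_div]
      push_cast
      ring_nf
    · rcases eq_or_ne j (i + 2) with rfl | h2
      · simp [offDiag_eq hM (i + 1), hβ]
      · rcases eq_or_ne j i with rfl | h3
        · simp [offDiag_eq hM, hβ]
          omega
        · simp [h1, h2, h3, h1.symm, Ne.symm h3]

end Bidiagonal


open Matrix

variable {M : ℝ}

/-! ### The upper bound of the Markov-Bernstein constant -/

/-- Induction step of `sq_mul_b_le`: here `b₁ = b_{j+1}`, `v = v_j`, `w = v_{j+1}`, and `S` is the
sum over the later indices. -/
theorem weighted_sq_le {b₁ M v w S : ℝ} (k : ℕ) (h1 : 0 < b₁) (hM : 0 ≤ M) (hS : 0 ≤ S)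
    (h : w ^ 2 * (b₁ + M + M * k) ≤ (b₁ + M) * k * S) :
    v ^ 2 * (b₁ + M + M * k)
      ≤ b₁ * (k + 1) * (((b₁ + M) * v + b₁ * w) ^ 2 / (b₁ * (b₁ + M)) + S) := by
  have h2 : 0 < b₁ + M := by positivity
  have e : b₁ * (k + 1) * (((b₁ + M) * v + b₁ * w) ^ 2 / (b₁ * (b₁ + M)) + S)
      = ((k + 1) * ((b₁ + M) * v + b₁ * w) ^ 2 + b₁ * (b₁ + M) * (k + 1) * S) / (b₁ + M) := by
    field_simp
  rw [e, le_div_iff₀ h2]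
  rcases k.eq_zero_or_pos with rfl | hk
  · have hw : w = 0 := by
      simp only [Nat.cast_zero, mul_zero, add_zero, zero_mul] at h
      exact pow_eq_zero_iff two_ne_zero |>.1
        (le_antisymm (nonpos_of_mul_nonpos_left h h2) (sq_nonneg w))
    have : 0 ≤ b₁ * (b₁ + M) * S := by positivity
    rw [hw]
    push_cast
    linarith
  · have hk' : (0 : ℝ) < k := by exact_mod_cast hk
    -- After multiplication by `k`, the difference is a square plus a nonnegative multiple of the
    -- defect in `h`.
    have key : k * ((k + 1) * ((b₁ + M) * v + b₁ * w) ^ 2 + b₁ * (b₁ + M) * (k + 1) * S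
          - v ^ 2 * (b₁ + M + M * k) * (b₁ + M))
        = b₁ * (b₁ + M) * (k * v + (k + 1) * w) ^ 2
          + b₁ * (k + 1) * ((b₁ + M) * k * S - w ^ 2 * (b₁ + M + M * k)) := by
      ring
    have hpos : 0 ≤ b₁ * (b₁ + M) * (k * v + (k + 1) * w) ^ 2
        + b₁ * (k + 1) * ((b₁ + M) * k * S - w ^ 2 * (b₁ + M + M * k)) :=
      add_nonneg (by positivity) (mul_nonneg (by positivity) (sub_nonneg.2 h))
    rw [← key] at hpos
    exact sub_nonneg.1 (nonneg_of_mul_nonneg_right hpos hk')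

/-- With `z = Rᵀ v` and `u_j = (-1)^j v_j / b_{j+1}` one has `u_j - u_{j+1} = (-1)^j z_j / √(b_{j+1}
b_{j+2})`. The bound is Cauchy-Schwarz for the telescoped sum, since `∑_{j ≤ i < j+k} 1 / (b_{i+1}
b_{i+2}) = k / (b_{j+1} b_{j+k+1})`. -/
theorem sq_mul_b_le (hM : 0 ≤ M) (v : ℕ → ℝ) (k j : ℕ) (hv : v (j + k) = 0) :
    v j ^ 2 * b M (j + k + 1) ≤ b M (j + 1) * k
      * ∑ i ∈ Finset.Ico j (j + k), (β M i * v i + v (i + 1) / β M i) ^ 2 := by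
  induction k generalizing j with
  | zero => simp_all
  | succ k ih =>
    have h := ih (j + 1) (by rwa [show j + 1 + k = j + (k + 1) by ring])
    rw [Finset.sum_eq_sum_Ico_succ_bot (by omega), show j + (k + 1) = j + 1 + k by ring]
    have hS0 : 0 ≤ ∑ i ∈ Finset.Ico (j + 1) (j + 1 + k), (β M i * v i + v (i + 1) / β M i) ^ 2 :=
      Finset.sum_nonneg fun i _ => sq_nonneg _
    have h1 := b_pos hM (t := j + 1) (by positivity)
    have h2 := b_pos hM (t := j + 2) (by positivity)
    have eN : b M (j + 1 + k + 1) = b M (j + 1) + M + M * k := by unfold b; ring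
    have e2 : b M (j + 2) = b M (j + 1) + M := by unfold b; ring
    have hz : (β M j * v j + v (j + 1) / β M j) ^ 2
        = (b M (j + 2) * v j + b M (j + 1) * v (j + 1)) ^ 2 / (b M (j + 1) * b M (j + 2)) := by
      have hβ := (β_pos hM j).ne'
      have e : (β M j * v j + v (j + 1) / β M j) ^ 2
          = (β M j ^ 2 * v j + v (j + 1)) ^ 2 / β M j ^ 2 := by field_simp
      rw [e, β_sq hM]
      field_simp
    push_cast at h ⊢
    rw [show (j : ℝ) + 1 + 1 = j + 2 by ring, eN, e2] at h
    rw [show (j : ℝ) + (k + 1) + 1 = j + 1 + k + 1 by ring, eN, hz, e2]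
    exact weighted_sq_le k h1 hM hS0 h

theorem sum_b_mul_sub (M c : ℝ) (n : ℕ) :
    ∑ j ∈ Finset.range n, b M (j + 1) * (c - j)
      = c * n - n * (n - 1) / 2 + M * (c * (n * (n + 1)) / 2 - (n - 1) * n * (n + 1) / 3) := by
  induction n with
  | zero => simp
  | succ n ih =>
    rw [Finset.sum_range_succ, ih, b]
    push_cast
    ring

theorem sum_sq_le (hM : 0 ≤ M) (n : ℕ) (v : ℕ → ℝ) (hv : v n = 0) :
    ∑ j ∈ Finset.range n, v j ^ 2 ≤ n * (n + 1) * (3 + (n + 2) * M) / (6 * (1 + (n + 1) * M))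
      * ∑ j ∈ Finset.range n, (β M j * v j + v (j + 1) / β M j) ^ 2 := by
  have hN := b_pos hM (t := n + 1) (by positivity)
  have h (j : ℕ) (hj : j ∈ Finset.range n) : v j ^ 2 * b M (n + 1) ≤ b M (j + 1) * (n - j)
      * ∑ i ∈ Finset.range n, (β M i * v i + v (i + 1) / β M i) ^ 2 := by
    have hjn := Finset.mem_range.1 hj
    obtain ⟨k, rfl⟩ := Nat.exists_eq_add_of_lt hjn
    have h := sq_mul_b_le hM v (k + 1) j hv
    have hb := b_pos hM (t := j + 1) (by positivity)
    push_cast at h ⊢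
    rw [show (j : ℝ) + k + 1 - j = k + 1 by ring, show (j : ℝ) + k + 1 + 1 = j + (k + 1) + 1 by ring]
    refine h.trans (mul_le_mul_of_nonneg_left ?_ (by positivity))
    refine Finset.sum_le_sum_of_subset_of_nonneg (fun i hi => ?_) fun i _ _ => sq_nonneg _
    rw [Finset.mem_Ico] at hi
    rw [Finset.mem_range]
    omega
  have h' := Finset.sum_le_sum h
  rw [← Finset.sum_mul, ← Finset.sum_mul, ← le_div_iff₀ hN, sum_b_mul_sub] at h'
  refine h'.trans_eq ?_
  have : (0 : ℝ) < 1 + (n + 1) * M := by positivity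
  rw [b]
  field_simp
  ring

/-! ### Polynomials in terms of vectors -/

/-- The coefficients, with respect to the monic orthogonal polynomials of `c₀`, of the primitive
of `∑ x_j T_j / j!` with coefficient `a` of index `0`. -/
noncomputable def primitiveCoeff (M a : ℝ) (x : ℕ → ℝ) : ℕ → ℝ
  | 0 => a
  | j + 1 => 1 / (j + 1) * (x j / j.factorial)
      + b M (j + 1) / b M (j + 2) * (x (j + 1) / (j + 1).factorial)

theorem lagD_zero (M : ℝ) : lagD M 0 = 1 := by simp [lagD, lag_zero]

/-- Coherence makes the sum telescope; only the boundary term with `x n` is left, and it vanishes in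
the applications. -/
theorem derivative_sum_primitiveCoeff (hM : 0 ≤ M) (a : ℝ) (x : ℕ → ℝ) (n : ℕ) :
    derivative (∑ j ∈ Finset.range (n + 1), primitiveCoeff M a x j • lagD M j)
      = ∑ j ∈ Finset.range n, (x j / j.factorial) • lag j
        + (b M n / b M (n + 1) * (x n / n.factorial)) • derivative (lagD M n) := by
  induction n with
  | zero => simp [lagD_zero]
  | succ n ih =>
    rw [Finset.sum_range_succ, derivative_add, ih, Finset.sum_range_succ _ n,
      lag_eq_derivative_lagD hM n, derivative_smul, primitiveCoeff]
    push_cast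
    rw [show (n : ℝ) + 1 + 1 = n + 2 by ring]
    module

theorem c1_derivative_sum_primitiveCoeff (hM : 0 ≤ M) (a : ℝ) (x : ℕ → ℝ) (n : ℕ)
    (hx : x n = 0) :
    c1 (derivative (∑ j ∈ Finset.range (n + 1), primitiveCoeff M a x j • lagD M j) ^ 2)
      = ∑ j ∈ Finset.range n, x j ^ 2 := by
  rw [derivative_sum_primitiveCoeff hM, hx, zero_div, mul_zero, zero_smul, add_zero,
    ← c1Lin_apply, map_sum_sq lag_monic lag_natDegree c1Lin_lag_mul_of_degree_lt]
  refine Finset.sum_congr rfl fun j _ => ?_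
  have : (j.factorial : ℝ) ≠ 0 := by positivity
  rw [c1Lin_lag_sq]
  field_simp

theorem c0_sum_primitiveCoeff (hM : 0 ≤ M) (a : ℝ) (x : ℕ → ℝ) (n : ℕ) :
    c0 M ((∑ j ∈ Finset.range (n + 1), primitiveCoeff M a x j • lagD M j) ^ 2)
      = ∑ j ∈ Finset.range n, (β M j * x j + x (j + 1) / β M j) ^ 2 + a ^ 2 * (1 + M) := by
  change c0Lin M _ = _
  rw [map_sum_sq (lagD_monic M) (lagD_natDegree M) (c0Lin_lagD_mul_of_degree_lt hM),
    Finset.sum_range_succ']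
  congr 1
  · refine Finset.sum_congr rfl fun j _ => ?_
    have hf : (j.factorial : ℝ) ≠ 0 := by positivity
    have hj : (j : ℝ) + 1 ≠ 0 := by positivity
    have h1 := (b_pos hM (t := j + 1) (by positivity)).ne'
    have h2 := (b_pos hM (t := j + 2) (by positivity)).ne'
    have hβ := (β_pos hM j).ne'
    have e : (β M j * x j + x (j + 1) / β M j) ^ 2
        = (x j + x (j + 1) / β M j ^ 2) ^ 2 * β M j ^ 2 := by field_simp
    rw [c0Lin_lagD_sq hM, primitiveCoeff, e, β_sq hM, Nat.factorial_succ]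
    push_cast
    rw [show (j : ℝ) + 1 + 1 = j + 2 by ring]
    field_simp
  · rw [c0Lin_lagD_sq hM, primitiveCoeff]
    simp [b]

theorem natDegree_sum_lagD_le (M : ℝ) (a : ℕ → ℝ) (n : ℕ) :
    (∑ j ∈ Finset.range (n + 1), a j • lagD M j).natDegree ≤ n := by
  refine natDegree_sum_le_of_forall_le _ _ fun j hj => (natDegree_smul_le _ _).trans ?_
  rw [lagD_natDegree]
  exact Nat.lt_succ_iff.1 (Finset.mem_range.1 hj)

theorem exists_eq_sum_primitiveCoeff (hM : 0 ≤ M) {n : ℕ} {p : ℝ[X]} (hp : p.natDegree ≤ n) :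
    ∃ a x, x n = 0 ∧
      p = ∑ j ∈ Finset.range (n + 1), primitiveCoeff M a x j • lagD M j := by
  have hdeg : (derivative p).degree < n := by
    rcases eq_or_ne p 0 with rfl | h
    · simp
    · exact (degree_derivative_lt h).trans_le (degree_le_of_natDegree_le hp)
  obtain ⟨d, hd⟩ := exists_eq_sum_of_monic lag_monic lag_natDegree n _ hdeg
  -- Scaling by `j!` normalises the `T_j`; the cut-off at `n` provides `x n = 0`.
  obtain ⟨x, hx⟩ : ∃ x : ℕ → ℝ, x = fun j => if j < n then d j * j.factorial else 0 := ⟨_, rfl⟩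
  have hxn : x n = 0 := by simp [hx]
  have h0 : derivative
      (p - ∑ j ∈ Finset.range (n + 1), primitiveCoeff M 0 x j • lagD M j) = 0 := by
    rw [derivative_sub, derivative_sum_primitiveCoeff hM, hxn, hd, zero_div, mul_zero, zero_smul,
      add_zero, sub_eq_zero]
    refine Finset.sum_congr rfl fun j hj => ?_
    have : (j.factorial : ℝ) ≠ 0 := by positivity
    simp only [hx, if_pos (Finset.mem_range.1 hj)]
    rw [mul_div_cancel_right₀ _ this]
  have hC := eq_C_of_natDegree_eq_zero (derivative_eq_zero.1 h0)
  refine ⟨(p - ∑ j ∈ Finset.range (n + 1), primitiveCoeff M 0 x j • lagD M j).coeff 0, x, hxn,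
    (eq_add_of_sub_eq hC).trans ?_⟩
  generalize (p - ∑ j ∈ Finset.range (n + 1), primitiveCoeff M 0 x j • lagD M j).coeff 0 = a
  rw [Finset.sum_range_succ', Finset.sum_range_succ' _ n, lagD_zero]
  simp only [primitiveCoeff, zero_smul, add_zero, smul_eq_C_mul, mul_one]
  rw [add_comm]

/-! ### Quadratic forms -/

theorem dotProduct_self_eq_sum_range (n : ℕ) (v : ℕ → ℝ) :
    (fun i : Fin n => v i) ⬝ᵥ (fun i : Fin n => v i) = ∑ j ∈ Finset.range n, v j ^ 2 := by
  rw [← Fin.sum_univ_eq_sum_range (fun j => v j ^ 2)]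
  simp [dotProduct, sq]

theorem bidiag_transpose_dotProduct_self (M : ℝ) (n : ℕ) (v : ℕ → ℝ) (hv : v n = 0) :
    ((bidiag M n)ᵀ *ᵥ fun i => v i) ⬝ᵥ ((bidiag M n)ᵀ *ᵥ fun i => v i)
      = ∑ j ∈ Finset.range n, (β M j * v j + v (j + 1) / β M j) ^ 2 := by
  rw [← dotProduct_self_eq_sum_range n fun j => β M j * v j + v (j + 1) / β M j]
  congr 1 <;> exact funext fun j => bidiag_transpose_mulVec M n v hv j

theorem isLeast_mu1 (hM : 0 ≤ M) {n : ℕ} (hn : 1 ≤ n) :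
    IsLeast {x : ℝ | (A M n).eval x = 0} (mu1 M n) := by
  refine isLeast_sInf_charpoly_roots hn ?_
  rw [Ktilde_eq hM]
  simpa using Matrix.isHermitian_mul_conjTranspose_self (bidiag M n)

theorem mem_lowerBounds_mu1 (hM : 0 ≤ M) {n : ℕ} (hn : 1 ≤ n) :
    mu1 M n ∈ lowerBounds {x | (bidiag M n * (bidiag M n)ᵀ).charpoly.eval x = 0} := by
  rw [← Ktilde_eq hM]
  exact (isLeast_mu1 hM hn).2

theorem mu1_mul_sum_sq_le (hM : 0 ≤ M) {n : ℕ} (hn : 1 ≤ n) (v : ℕ → ℝ) (hv : v n = 0) :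
    mu1 M n * ∑ j ∈ Finset.range n, v j ^ 2
      ≤ ∑ j ∈ Finset.range n, (β M j * v j + v (j + 1) / β M j) ^ 2 := by
  have h := mem_lowerBounds_mu1 hM hn
  rw [Matrix.charpoly_mul_comm, ← Matrix.transpose_transpose (bidiag M n),
    Matrix.transpose_transpose (bidiag M n)ᵀ] at h
  have := (mul_dotProduct_le_of_mem_lowerBounds (R := (bidiag M n)ᵀ) h fun i => v i).1
  rwa [dotProduct_self_eq_sum_range, bidiag_transpose_dotProduct_self M n v hv] at this

theorem exists_mu1_mul_sum_sq_eq (hM : 0 ≤ M) {n : ℕ} (hn : 1 ≤ n) :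
    ∃ v : ℕ → ℝ, v n = 0 ∧ 0 < ∑ j ∈ Finset.range n, v j ^ 2 ∧
      mu1 M n * ∑ j ∈ Finset.range n, v j ^ 2
        = ∑ j ∈ Finset.range n, (β M j * v j + v (j + 1) / β M j) ^ 2 := by
  obtain ⟨w, hw0, hw⟩ := (eval_charpoly_eq_zero_iff _ _).1 (isLeast_mu1 hM hn).1
  obtain ⟨v, hvn, rfl⟩ : ∃ v : ℕ → ℝ, v n = 0 ∧ w = fun i : Fin n => v i :=
    ⟨fun j => if h : j < n then w ⟨j, h⟩ else 0, by simp, by ext i; simp⟩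
  refine ⟨v, hvn, ?_, ?_⟩
  · rw [← dotProduct_self_eq_sum_range]
    exact lt_of_le_of_ne (Finset.sum_nonneg fun i _ => mul_self_nonneg _) (Ne.symm (mt dotProduct_self_eq_zero.1 hw0))
  · rw [← bidiag_transpose_dotProduct_self M n v hvn, ← dotProduct_self_eq_sum_range]
    have : (fun i : Fin n => v i) ⬝ᵥ (Ktilde M n *ᵥ fun i => v i)
        = mu1 M n * ((fun i : Fin n => v i) ⬝ᵥ fun i => v i) := by
      rw [hw, dotProduct_smul, smul_eq_mul]
    rw [← this, Ktilde_eq hM, ← Matrix.mulVec_mulVec, Matrix.dotProduct_mulVec,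
      ← Matrix.mulVec_transpose]

theorem one_le_mul_mu1 (hM : 0 ≤ M) {n : ℕ} (hn : 1 ≤ n) :
    1 ≤ n * (n + 1) * (3 + (n + 2) * M) / (6 * (1 + (n + 1) * M)) * mu1 M n := by
  obtain ⟨v, hv, hpos, heq⟩ := exists_mu1_mul_sum_sq_eq hM hn
  have h := sum_sq_le hM n v hv
  rw [← heq, ← mul_assoc] at h
  exact le_of_mul_le_mul_right (by rwa [one_mul]) hpos

theorem mu1_pos (hM : 0 ≤ M) {n : ℕ} (hn : 1 ≤ n) : 0 < mu1 M n :=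
  pos_of_mul_pos_right (one_pos.trans_le (one_le_mul_mu1 hM hn)) (by positivity)

theorem isLeast_markovBernsteinConstants (hM : 0 ≤ M) {n : ℕ} (hn : 1 ≤ n) :
    IsLeast (markovBernsteinConstants M n) (1 / Real.sqrt (mu1 M n)) := by
  have hm := mu1_pos hM hn
  refine ⟨⟨by positivity, fun p hp => ?_⟩, fun K ⟨hK, h⟩ => ?_⟩
  · obtain ⟨a, x, hx, rfl⟩ := exists_eq_sum_primitiveCoeff hM hp
    rw [c1_derivative_sum_primitiveCoeff hM a x n hx, c0_sum_primitiveCoeff hM, div_pow, one_pow,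
      Real.sq_sqrt hm.le, one_div_mul_eq_div, le_div_iff₀ hm, mul_comm]
    have := mu1_mul_sum_sq_le hM hn x hx
    have : 0 ≤ a ^ 2 * (1 + M) := by positivity
    linarith
  · obtain ⟨v, hv, hpos, heq⟩ := exists_mu1_mul_sum_sq_eq hM hn
    -- The extremal polynomial has coefficient 0 at `P_0`, which only enlarges `c₀(p²)`, and an
    -- eigenvector for `μ_{1,n}` as its `x`.
    have h' := h _ (natDegree_sum_lagD_le M (primitiveCoeff M 0 v) n)
    rw [c1_derivative_sum_primitiveCoeff hM 0 v n hv, c0_sum_primitiveCoeff hM, ← heq] at h'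
    have h1 : 1 ≤ K ^ 2 * mu1 M n := by
      refine le_of_mul_le_mul_right ?_ hpos
      linarith
    rw [div_le_iff₀ (Real.sqrt_pos.2 hm)]
    refine (one_le_sq_iff₀ (by positivity)).1 ?_
    rwa [mul_pow, Real.sq_sqrt hm.le]

theorem markovBernstein_eq (hM : 0 ≤ M) {n : ℕ} (hn : 1 ≤ n) :
    markovBernstein M n = 1 / Real.sqrt (mu1 M n) :=
  (isLeast_markovBernsteinConstants hM hn).csInf_eq

/-! ### The test vector of the qd algorithm -/

/-- The vector whose Rayleigh quotient with respect to `Rᵀ R`, `R = bidiag M n`, is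
`q_n^{(2)}`. -/
noncomputable def testVec (M : ℝ) (i : ℕ) : ℝ :=
  (-1) ^ i * (sumSqB M (i + 1) / (b M (i + 1) * β M i))

/-- The image `((-1)^i b_{i+1})` is annihilated by every row of `Rᵀ` except the last. Thus `testVec`
is a multiple of `(Rᵀ R)⁻¹ e_n`, with `e_n` the last basis vector. -/
theorem bidiag_mulVec_testVec (hM : 0 ≤ M) (n : ℕ) :
    (bidiag M n *ᵥ fun i => testVec M i) = fun i : Fin n => (-1) ^ (i : ℕ) * b M (i + 1) := by
  ext ⟨i, hi⟩
  cases i with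
  | zero =>
    rw [bidiag_mulVec_zero M _ ⟨0, hi⟩ rfl]
    have hβ := (β_pos hM 0).ne'
    have h1 := (b_pos hM (t := 1) (by positivity)).ne'
    have hB1 : sumSqB M 1 = b M 1 ^ 2 := by unfold sumSqB b; ring
    simp only [testVec, Nat.cast_zero, zero_add, hB1, pow_zero]
    field_simp
  | succ i =>
    rw [bidiag_mulVec_succ M _ ⟨i + 1, hi⟩ i rfl]
    have hβ := (β_pos hM i).ne'
    have hβ' := (β_pos hM (i + 1)).ne'
    have h1 := (b_pos hM (t := i + 1) (by positivity)).ne'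
    have h2 := (b_pos hM (t := i + 2) (by positivity)).ne'
    have hB := sumSqB_add_one M (i + 1)
    have e : testVec M i / β M i = (-1) ^ i * (sumSqB M (i + 1) / b M (i + 2)) := by
      have : testVec M i / β M i
          = (-1) ^ i * (sumSqB M (i + 1) / (b M (i + 1) * β M i ^ 2)) := by
        rw [testVec]
        field_simp
      rw [this, β_sq hM]
      field_simp
    rw [e, testVec]
    push_cast
    rw [show (i : ℝ) + 1 + 1 = i + 2 by ring] at hB ⊢
    rw [hB, pow_succ]
    field_simp
    ring

theorem sum_testVec_sq (hM : 0 ≤ M) (n : ℕ) :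
    ∑ i ∈ Finset.range n, testVec M i ^ 2 = sumSqS M n / b M (n + 1) := by
  rw [← sum_sumSqB_sq hM]
  refine Finset.sum_congr rfl fun i _ => ?_
  have h1 := (b_pos hM (t := i + 1) (by positivity)).ne'
  have h2 := (b_pos hM (t := i + 2) (by positivity)).ne'
  rw [testVec, mul_pow, ← pow_mul, mul_comm i 2, pow_mul, neg_one_sq, one_pow, one_mul, div_pow,
    mul_pow, β_sq hM]
  field_simp

theorem mu1_le_qdQ_two (hM : 0 ≤ M) {n : ℕ} (hn : 1 ≤ n) :
    mu1 M n ≤ qdQ M n 2 n ∧ (2 ≤ n → mu1 M n ≠ qdQ M n 2 n) := by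
  have hn0 : (0 : ℝ) < n := by positivity
  have hS := sumSqS_pos hM hn0
  have hb := b_pos hM (t := n + 1) (by positivity)
  have h := mul_dotProduct_le_of_mem_lowerBounds (mem_lowerBounds_mu1 hM hn)
    fun i : Fin n => testVec M i
  rw [bidiag_mulVec_testVec hM, dotProduct_self_eq_sum_range,
    dotProduct_self_eq_sum_range n fun i => (-1) ^ i * b M (i + 1), sum_testVec_sq hM] at h
  have e : ∑ j ∈ Finset.range n, ((-1) ^ j * b M (j + 1)) ^ 2 = sumSqB M n := by
    rw [← sum_b_sq]
    refine Finset.sum_congr rfl fun i _ => ?_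
    rw [mul_pow, ← pow_mul, mul_comm i 2, pow_mul, neg_one_sq, one_pow, one_mul]
  rw [e] at h
  rw [qdQ_two_self hM hn]
  refine ⟨?_, fun hn2 heq => ?_⟩
  · rw [le_div_iff₀ hS, mul_comm (b M (n + 1)), ← div_le_iff₀ hb, mul_div_assoc]
    exact h.1
  -- Equality would make `testVec` an eigenvector of `Rᵀ R` for `μ_{1,n}`. Its first coordinate is
  -- positive, but for `n ≥ 2` that of its image is 0, because `β_0² = b_2 / b_1`.
  · have h' := congrFun (h.2 (by rw [heq]; field_simp)) ⟨0, hn⟩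
    have e' : (fun i : Fin n => (-1) ^ (i : ℕ) * b M ((i : ℕ) + 1)) = fun i : Fin n =>
        (fun i : ℕ => if i < n then (-1) ^ i * b M (i + 1) else 0) i := by
      ext i
      simp
    have h1 := b_pos hM (t := 1) (by positivity)
    rw [e', bidiag_transpose_mulVec M n
      (fun i : ℕ => if i < n then (-1) ^ i * b M (i + 1) else 0) (by simp)] at h'
    have hβ := β_pos hM 0
    have hβ2 := β_sq hM 0
    have hm := mu1_pos hM hn
    have hB := sumSqB_pos hM (t := 1) one_pos
    simp only [if_pos (show 0 < n by omega), if_pos (show 0 + 1 < n by omega), Pi.smul_apply,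
      testVec, Nat.cast_zero, zero_add, pow_zero, pow_one, one_mul, Nat.cast_one, smul_eq_mul,
      one_add_one_eq_two] at h' hβ2
    have hz : β M 0 * b M 1 + -1 * b M 2 / β M 0 = 0 := by
      rw [eq_div_iff h1.ne'] at hβ2
      field_simp
      linarith
    rw [hz] at h'
    have : 0 < mu1 M n * (sumSqB M 1 / (b M 1 * β M 0)) := by positivity
    exact this.ne h'

theorem mu1_one_eq_qdQ_two (M : ℝ) (hM : 0 ≤ M) : mu1 M 1 = qdQ M 1 2 1 := by
  have h : (A M 1).eval (mu1 M 1) = 0 := (isLeast_mu1 hM le_rfl).1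
  rw [A, Matrix.eval_charpoly, Matrix.det_fin_one] at h
  simp [Ktilde, e0_zero, sub_eq_zero] at h
  rw [h]
  simp [qdQ, qd, qdStepQ, qdStepE, e0_self]

end LaguerreDirac

theorem mainTheorem4 (M : ℝ) (hM : 0 ≤ M) :
    -- the `σ_n` are the coefficients of the coherence relation
    LaguerreDirac.IsCoherent M ∧
    ∀ n : ℕ, 1 ≤ n →
      -- `μ_{1,n}` is the smallest zero of `A_n`, and `M_n` is the best constant
      IsLeast {x : ℝ | (LaguerreDirac.A M n).eval x = 0} (LaguerreDirac.mu1 M n) ∧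
      IsLeast (LaguerreDirac.markovBernsteinConstants M n) (LaguerreDirac.markovBernstein M n) ∧
      -- the value of `q_n^{(2)}` in the qd algorithm
      LaguerreDirac.qdQ M n 2 n =
        30 * (1 + ((n : ℝ) + 1) * M) / (((n : ℝ) + 1) * (2 * (n : ℝ) + 1))
          * (LaguerreDirac.p1 M ((n : ℝ) - 1) / LaguerreDirac.p2 M ((n : ℝ) - 1)) ∧
      -- the upper bound of `μ_{1,n}`, strict unless `n = 1`
      (2 ≤ n → LaguerreDirac.mu1 M n < LaguerreDirac.qdQ M n 2 n) ∧
      (n = 1 → LaguerreDirac.mu1 M n = LaguerreDirac.qdQ M n 2 n) ∧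
      -- the bounds of `M_n`
      1 / Real.sqrt (LaguerreDirac.qdQ M n 2 n) ≤ LaguerreDirac.markovBernstein M n ∧
      LaguerreDirac.markovBernstein M n ≤
        Real.sqrt ((n : ℝ) * ((n : ℝ) + 1) * (3 + ((n : ℝ) + 2) * M)
          / (1 + ((n : ℝ) + 1) * M)) := by
  refine ⟨LaguerreDirac.isCoherent hM, fun n hn => ?_⟩
  have hm := LaguerreDirac.mu1_pos hM hn
  have hle := LaguerreDirac.mu1_le_qdQ_two hM hn
  refine ⟨LaguerreDirac.isLeast_mu1 hM hn, ?_, LaguerreDirac.qdQ_two_self_eq_p1_div_p2 hM hn,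
    fun hn2 => lt_of_le_of_ne hle.1 (hle.2 hn2), ?_, ?_, ?_⟩
  · rw [LaguerreDirac.markovBernstein_eq hM hn]
    exact LaguerreDirac.isLeast_markovBernsteinConstants hM hn
  · rintro rfl
    exact LaguerreDirac.mu1_one_eq_qdQ_two M hM
  · rw [LaguerreDirac.markovBernstein_eq hM hn]
    exact one_div_le_one_div_of_le (Real.sqrt_pos.2 hm) (Real.sqrt_le_sqrt hle.1)
  · rw [LaguerreDirac.markovBernstein_eq hM hn, Real.le_sqrt' (by positivity), div_pow, one_pow,
      Real.sq_sqrt hm.le, div_le_iff₀ hm]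
    -- The bound obtained for `M_n²` is one sixth of the one required.
    refine (LaguerreDirac.one_le_mul_mu1 hM hn).trans (mul_le_mul_of_nonneg_right ?_ hm.le)
    have : (0 : ℝ) < 1 + (n + 1) * M := by positivity
    gcongr
    linarith
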